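/- Let $d\geq 2$. By a $d$-dimensional polytope in $\mathbb{R}^d$ we mean the convex hull of a finite subset of $\mathbb{R}^d$ whose affine hull is $\mathbb{R}^d$; it is a lattice polytope if all its vertices belong to $\mathbb{Z}^d$. Let $P$ be such a polytope with vertex set $\mathcal{V}$. A point $x\in\mathbb{R}^d\setminus P$ can be inserted in $P$ if the convex hull of $P\cup\{x\}$ has vertex set $\mathcal{V}\cup\{x\}$; the insertion move then transforms $P$ into the convex hull of $P\cup\{x\}$. A vertex $v\in\mathcal{V}$ can be deleted from $P$ if the convex hull of $\mathcal{V}\setminus\{v\}$ is $d$-dimensional; the deletion move then transforms $P$ into the convex hull of $\mathcal{V}\setminus\{v\}$. Let $\Gamma(d)$ be the graph whose vertices are the $d$-dimensional polytopes contained in $\mathbb{R}^d$ and whose edges connect any two polytopes that can be obtained from one another by an insertion or a deletion move, and let $\Lambda(d)$ be the subgraph induced in $\Gamma(d)$ by the lattice polytopes. **Theorem.** For every $d\geq 2$, the graph $\Lambda(d)$ is connected, and the subgraph induced in $\Lambda(d)$ by the simplices and the polytopes with exactly $d+2$ vertices is connected. -/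

import Mathlib

namespace PolytopeMoves

/-- `P` is a `d`-dimensional polytope contained in `ℝ^d`: the convex hull of a finite set of points,
whose affine hull is the whole space. -/
def IsFullPolytope {d : ℕ} (P : Set (EuclideanSpace ℝ (Fin d))) : Prop :=
  (∃ s : Set (EuclideanSpace ℝ (Fin d)), s.Finite ∧ P = convexHull ℝ s) ∧
    affineSpan ℝ P = ⊤

/-- The type of the `d`-dimensional polytopes contained in `ℝ^d`. -/
abbrev Polytope (d : ℕ) : Type :=
  {P : Set (EuclideanSpace ℝ (Fin d)) // IsFullPolytope P}

/-- The vertex set of a polytope: its extreme points. -/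
def Polytope.vertices {d : ℕ} (P : Polytope d) : Set (EuclideanSpace ℝ (Fin d)) :=
  Set.extremePoints ℝ P.1

/-- The point `x`, outside of `P`, can be inserted in `P`: the vertex set of the convex hull
of `P ∪ {x}` is the vertex set of `P` together with `x`. -/
def CanInsert {d : ℕ} (P : Polytope d) (x : EuclideanSpace ℝ (Fin d)) : Prop :=
  x ∉ P.1 ∧ Set.extremePoints ℝ (convexHull ℝ (P.1 ∪ {x})) = P.vertices ∪ {x}

/-- The vertex `v` can be deleted from `P`: the convex hull of the other vertices is still a
`d`-dimensional polytope. -/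
def CanDelete {d : ℕ} (P : Polytope d) (v : EuclideanSpace ℝ (Fin d)) : Prop :=
  v ∈ P.vertices ∧ IsFullPolytope (convexHull ℝ (P.vertices \ {v}))

/-- `Q` is obtained from `P` by an insertion move. -/
def IsInsertionMove {d : ℕ} (P Q : Polytope d) : Prop :=
  ∃ x, CanInsert P x ∧ Q.1 = convexHull ℝ (P.1 ∪ {x})

/-- `Q` is obtained from `P` by a deletion move. -/
def IsDeletionMove {d : ℕ} (P Q : Polytope d) : Prop :=
  ∃ v, CanDelete P v ∧ Q.1 = convexHull ℝ (P.vertices \ {v})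

/-- `Q` is obtained from `P` by an insertion move or a deletion move. -/
def IsMove {d : ℕ} (P Q : Polytope d) : Prop :=
  IsInsertionMove P Q ∨ IsDeletionMove P Q

theorem not_isMove_self {d : ℕ} (P : Polytope d) : ¬ IsMove P P := by
  rintro (⟨x, hx, h⟩ | ⟨v, hv, h⟩)
  · apply hx.1
    rw [h]
    exact subset_convexHull ℝ _ (Or.inr rfl)
  · have hmem : v ∈ convexHull ℝ (P.vertices \ {v}) := h ▸ hv.1.1
    have hext : v ∈ Set.extremePoints ℝ (convexHull ℝ (P.vertices \ {v})) := h ▸ hv.1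
    exact (extremePoints_convexHull_subset hext).2 rfl

/-- The graph `Γ(d)`: its vertices are the `d`-dimensional polytopes contained in `ℝ^d`, and its
edges connect any two polytopes that are obtained from one another by an insertion move or a
deletion move. -/
def Gamma (d : ℕ) : SimpleGraph (Polytope d) where
  Adj P Q := IsMove P Q ∨ IsMove Q P
  symm := ⟨fun _ _ h => h.symm⟩
  loopless := ⟨fun P h => h.elim (not_isMove_self P) (not_isMove_self P)⟩

/-- A lattice polytope: all its vertices belong to `ℤ^d`. -/
def Polytope.IsLattice {d : ℕ} (P : Polytope d) : Prop :=
  ∀ v ∈ P.vertices, ∀ i : Fin d, ∃ n : ℤ, v i = (n : ℝ)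

/-- A simplex: a polytope whose vertices are affinely independent. -/
def Polytope.IsSimplex {d : ℕ} (P : Polytope d) : Prop :=
  AffineIndependent ℝ (fun v : P.vertices => (v : EuclideanSpace ℝ (Fin d)))

/-- The graph `Λ(d)`: the subgraph induced in `Γ(d)` by the lattice polytopes. -/
def Lambda (d : ℕ) : SimpleGraph {P : Polytope d // P.IsLattice} :=
  (Gamma d).induce {P : Polytope d | P.IsLattice}

/-- The subgraph induced in `Λ(d)` by the simplices and the polytopes with `d + 2` vertices. -/
def LambdaSimplex (d : ℕ) :
    SimpleGraph {P : {P : Polytope d // P.IsLattice} //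
      P.1.IsSimplex ∨ P.1.vertices.ncard = d + 2} :=
  (Lambda d).induce {P : {P : Polytope d // P.IsLattice} |
    P.1.IsSimplex ∨ P.1.vertices.ncard = d + 2}

end PolytopeMoves

/-!
Deleting vertices one at a time leads from any lattice polytope to a simplex on `d + 1` of its
vertices, so everything reduces to connecting lattice simplices through simplices and polytopes with
`d + 2` vertices. By Steinitz exchange it is enough to replace a single vertex `p` of a simplex by
another lattice point `q`, the opposite facet `F` being fixed. If some barycentric coordinate of `q`
in the simplex is negative and two are positive, then `F ∪ {p, q}` is in convex position, and one
insertion followed by one deletion suffices. If `p` and `q` lie on the same side of `F`, choose two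
vertices `u`, `v` of `F`: for large `M` the lattice point `p + M (u - v)` satisfies the sign
condition relative to both simplices. If they lie on opposite sides, first replace `p` by
`u + v - p`, whose nonzero barycentric coordinates are `-1`, `1`, `1`.
-/

open Filter Module Set

namespace PolytopeMoves

section AffineBasis

variable {ι ι' k V W P : Type*} [AddCommGroup V] [AddTorsor V P] [AddCommGroup W]

theorem affineMap_add_smul_sub [Ring k] [Module k V] [Module k W] (f : V →ᵃ[k] W) (p a b : V)
    (t : k) : f (p + t • (a - b)) = f p + t • (f a - f b) := by
  rw [add_comm, ← vadd_eq_add, f.map_vadd, map_smul, ← vsub_eq_sub a b, f.linearMap_vsub,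
    vadd_eq_add, add_comm, vsub_eq_sub]

theorem affineMap_apply_eq_sum_coord_smul [Ring k] [Module k V] [Module k W] [Fintype ι]
    (b : AffineBasis ι k P) (f : P →ᵃ[k] W) (x : P) :
    f x = ∑ i, b.coord i x • f (b i) := by
  conv_lhs => rw [← b.affineCombination_coord_eq_self x]
  rw [Finset.map_affineCombination _ _ _ (b.sum_coord_apply_eq_one x),
    Finset.affineCombination_eq_linear_combination _ _ _ (b.sum_coord_apply_eq_one x)]
  rfl

theorem coord_eq_mul_coord_of_eqOn [Ring k] [Module k V] [Finite ι] {b c : AffineBasis ι k P}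
    {i : ι} (h : EqOn b c {i}ᶜ) (x : P) :
    b.coord i x = c.coord i x * b.coord i (c i) := by
  have := Fintype.ofFinite ι
  rw [affineMap_apply_eq_sum_coord_smul c (b.coord i), Finset.sum_eq_single i, smul_eq_mul]
  · intro l _ hl
    rw [← h hl, b.coord_apply_ne hl.symm, smul_zero]
  · simp

theorem exists_notMem_range_and_coord_ne_zero [Ring k] [Nontrivial k] [Module k V] [Finite ι]
    (b : AffineBasis ι k P) (c : AffineBasis ι' k P) {j : ι'} (hj : c j ∉ range b) :
    ∃ i, b i ∉ range c ∧ b.coord i (c j) ≠ 0 := by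
  have := Fintype.ofFinite ι
  have hsum := affineMap_apply_eq_sum_coord_smul b (c.coord j) (c j)
  rw [c.coord_apply_eq] at hsum
  obtain ⟨i, -, hi⟩ := Finset.exists_ne_zero_of_sum_ne_zero (hsum ▸ one_ne_zero)
  refine ⟨i, ?_, left_ne_zero_of_smul hi⟩
  rintro ⟨l, hl⟩
  have hjl : j ≠ l := fun h => hj ⟨i, by rw [h, hl]⟩
  exact right_ne_zero_of_smul hi (by rw [← hl, c.coord_apply_ne hjl])

variable [DivisionRing k] [Module k V]

theorem exists_affineBasis_eq_update [Finite ι] [DecidableEq ι] (b : AffineBasis ι k P) {i : ι}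
    {q : P} (hq : b.coord i q ≠ 0) : ∃ c : AffineBasis ι k P, ⇑c = Function.update b i q := by
  have := Fintype.ofFinite ι
  have := b.finiteDimensional
  have hind : AffineIndependent k (Function.update b i q) := by
    refine b.ind.affineIndependent_update_of_notMem_affineSpan fun hmem => hq ?_
    have hle : affineSpan k (b '' {x | x ≠ i}) ≤
        (AffineSubspace.mk' (0 : k) ⊥).comap (b.coord i) := by
      rw [affineSpan_le]
      rintro _ ⟨l, hl, rfl⟩
      simp [b.coord_apply_ne (Ne.symm hl)]
    simpa using hle hmem
  have hspan : affineSpan k (range (Function.update b i q)) = ⊤ :=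
    hind.affineSpan_eq_top_iff_card_eq_finrank_add_one.2 b.card_eq_finrank_add_one
  exact ⟨⟨_, hind, hspan⟩, rfl⟩

theorem exists_affineBasis_range_subset [FiniteDimensional k V] {s : Set P}
    (hs : affineSpan k s = ⊤) {n : ℕ} (hn : finrank k V = n) :
    ∃ b : AffineBasis (Fin (n + 1)) k P, range b ⊆ s := by
  obtain ⟨t, hts, b, hb⟩ := AffineBasis.exists_affine_subbasis hs
  have : Finite t := finite_set_of_fin_dim_affineIndependent k (hb ▸ b.ind)
  have := Fintype.ofFinite t
  have hcard : Fintype.card t = n + 1 := hn ▸ b.card_eq_finrank_add_one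
  refine ⟨b.reindex (Fintype.equivFinOfCardEq hcard), ?_⟩
  rintro _ ⟨i, rfl⟩
  rw [b.reindex_apply, hb]
  exact hts (Subtype.coe_prop _)

end AffineBasis

section ConvexIndependent

variable {ι 𝕜 E : Type*} [Field 𝕜] [LinearOrder 𝕜] [AddCommGroup E] [Module 𝕜 E]

theorem convexIndependent_of_affineIndependent {p : ι → E} (hp : AffineIndependent 𝕜 p) :
    ConvexIndependent 𝕜 p :=
  fun t i hi => (hp.mem_affineSpan_iff i t).1 (convexHull_subset_affineSpan _ hi)

variable [IsStrictOrderedRing 𝕜]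

theorem notMem_convexHull_of_affineMap_nonpos {s : Set E} {x : E} (f : E →ᵃ[𝕜] 𝕜)
    (hs : ∀ y ∈ s, f y ≤ 0) (hx : 0 < f x) : x ∉ convexHull 𝕜 s := fun hxs =>
  hx.not_ge (convexHull_min (t := f ⁻¹' Iic 0) hs ((convex_Iic 0).affine_preimage f) hxs)

theorem coord_apply_nonneg (b : AffineBasis ι 𝕜 E) (i j : ι) : 0 ≤ b.coord i (b j) := by
  classical
  rw [b.coord_apply]
  split_ifs
  exacts [zero_le_one, le_rfl]

theorem notMem_convexHull_range_of_coord_neg (b : AffineBasis ι 𝕜 E) {q : E} {m : ι}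
    (hm : b.coord m q < 0) : q ∉ convexHull 𝕜 (range b) :=
  notMem_convexHull_of_affineMap_nonpos (-b.coord m)
    (by rintro _ ⟨l, rfl⟩; exact neg_nonpos.2 (coord_apply_nonneg b m l)) (neg_pos.2 hm)

theorem notMem_convexHull_insert_of_coord_pos (b : AffineBasis ι 𝕜 E) {q : E} {i l : ι}
    (hil : i ≠ l) (hl : 0 < b.coord l q) : b i ∉ convexHull 𝕜 (insert q (b '' {i}ᶜ)) := by
  -- For `b.coord i q > 0` this function vanishes at `q` and at `b n` for all `n ≠ i, l`.
  let f : E →ᵃ[𝕜] 𝕜 := b.coord l q • b.coord i - max (b.coord i q) 0 • b.coord l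
  have hf (y : E) : f y = b.coord l q * b.coord i y - max (b.coord i q) 0 * b.coord l y := rfl
  refine notMem_convexHull_of_affineMap_nonpos f ?_ ?_
  · rintro y (rfl | ⟨n, hn, rfl⟩)
    · rw [hf, mul_comm, ← sub_mul]
      exact mul_nonpos_of_nonpos_of_nonneg (sub_nonpos.2 (le_max_left _ _)) hl.le
    · rw [hf, b.coord_apply_ne (Ne.symm hn), mul_zero, zero_sub, neg_nonpos]
      exact mul_nonneg (le_max_right _ _) (coord_apply_nonneg b l n)
  · rwa [hf, b.coord_apply_eq, b.coord_apply_ne hil.symm, mul_one, mul_zero, sub_zero]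

theorem convexIndependent_insert_range (b : AffineBasis ι 𝕜 E) {q : E} {m j k : ι}
    (hm : b.coord m q < 0) (hj : 0 < b.coord j q) (hk : 0 < b.coord k q) (hjk : j ≠ k) :
    ConvexIndependent 𝕜 ((↑) : ↥(insert q (range b)) → E) := by
  rw [convexIndependent_set_iff_notMem_convexHull_sdiff]
  rintro x (rfl | ⟨i, rfl⟩) hx
  · refine notMem_convexHull_range_of_coord_neg b hm (convexHull_mono ?_ hx)
    simp
  · obtain ⟨l, hil, hl⟩ : ∃ l, i ≠ l ∧ 0 < b.coord l q := by
      rcases eq_or_ne i j with rfl | hij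
      exacts [⟨k, hjk, hk⟩, ⟨j, hij, hj⟩]
    refine notMem_convexHull_insert_of_coord_pos b hil hl (convexHull_mono ?_ hx)
    rintro y ⟨rfl | ⟨n, rfl⟩, hy⟩
    exacts [mem_insert _ _, Or.inr ⟨n, fun hn => hy (congrArg b hn), rfl⟩]

end ConvexIndependent

section KreinMilman

variable {E : Type*} [AddCommGroup E] [Module ℝ E] [TopologicalSpace E] [T2Space E]
  [IsTopologicalAddGroup E] [ContinuousSMul ℝ E] [LocallyConvexSpace ℝ E] {s : Set E}

theorem convexHull_extremePoints_convexHull (hs : s.Finite) :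
    convexHull ℝ ((convexHull ℝ s).extremePoints ℝ) = convexHull ℝ s := by
  have h := closure_convexHull_extremePoints (hs.isCompact_convexHull ℝ) (convex_convexHull ℝ s)
  rwa [((hs.subset extremePoints_convexHull_subset).isClosed_convexHull ℝ).closure_eq] at h

theorem extremePoints_convexHull_of_convexIndependent (hs : s.Finite)
    (hc : ConvexIndependent ℝ ((↑) : s → E)) : (convexHull ℝ s).extremePoints ℝ = s := by
  refine extremePoints_convexHull_subset.antisymm fun x hx => by_contra fun hxe => ?_
  refine convexIndependent_set_iff_notMem_convexHull_sdiff.1 hc x hx ?_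
  refine convexHull_mono (subset_sdiff_singleton extremePoints_convexHull_subset hxe) ?_
  rw [convexHull_extremePoints_convexHull hs]
  exact subset_convexHull ℝ s hx

end KreinMilman

variable {d : ℕ}

namespace Polytope

theorem convexHull_vertices (P : Polytope d) : convexHull ℝ P.vertices = P.1 := by
  obtain ⟨_, ⟨s, hs, rfl⟩, _⟩ := P
  exact convexHull_extremePoints_convexHull hs

theorem vertices_injective : Function.Injective (vertices : Polytope d → _) := fun P Q h =>
  Subtype.ext (by rw [← P.convexHull_vertices, h, Q.convexHull_vertices])

theorem finite_vertices (P : Polytope d) : P.vertices.Finite := by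
  obtain ⟨_, ⟨s, hs, rfl⟩, _⟩ := P
  exact hs.subset extremePoints_convexHull_subset

theorem convexIndependent_vertices (P : Polytope d) :
    ConvexIndependent ℝ ((↑) : P.vertices → EuclideanSpace ℝ (Fin d)) := by
  obtain ⟨_, ⟨s, _, rfl⟩, _⟩ := P
  exact (convex_convexHull ℝ s).convexIndependent_extremePoints

theorem affineSpan_vertices (P : Polytope d) : affineSpan ℝ P.vertices = ⊤ := by
  rw [← affineSpan_convexHull, P.convexHull_vertices, P.2.2]

theorem exists_vertices_eq {s : Set (EuclideanSpace ℝ (Fin d))} (hs : s.Finite)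
    (hc : ConvexIndependent ℝ ((↑) : s → EuclideanSpace ℝ (Fin d)))
    (hspan : affineSpan ℝ s = ⊤) : ∃ P : Polytope d, P.vertices = s :=
  ⟨⟨convexHull ℝ s, ⟨s, hs, rfl⟩, by rw [affineSpan_convexHull, hspan]⟩,
    extremePoints_convexHull_of_convexIndependent hs hc⟩

theorem exists_vertices_eq_of_subset (P : Polytope d) {s : Set (EuclideanSpace ℝ (Fin d))}
    (hs : s ⊆ P.vertices) (hspan : affineSpan ℝ s = ⊤) : ∃ Q : Polytope d, Q.vertices = s :=
  exists_vertices_eq (P.finite_vertices.subset hs) (P.convexIndependent_vertices.mono hs) hspan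

theorem ncard_vertices_of_isSimplex {P : Polytope d} (hP : P.IsSimplex) :
    P.vertices.ncard = d + 1 := by
  have := P.finite_vertices.fintype
  have hspan : affineSpan ℝ (range ((↑) : P.vertices → EuclideanSpace ℝ (Fin d))) = ⊤ := by
    rw [Subtype.range_coe, P.affineSpan_vertices]
  rw [← Nat.card_coe_set_eq, Nat.card_eq_fintype_card,
    hP.affineSpan_eq_top_iff_card_eq_finrank_add_one.1 hspan, finrank_euclideanSpace_fin]

end Polytope

theorem gamma_adj_of_vertices_eq_insert {P Q : Polytope d} {x : EuclideanSpace ℝ (Fin d)}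
    (hx : x ∉ P.vertices) (h : Q.vertices = insert x P.vertices) : (Gamma d).Adj P Q := by
  have hQ : convexHull ℝ (P.1 ∪ {x}) = Q.1 := by
    rw [← P.convexHull_vertices, convexHull_convexHull_union_left, union_singleton, ← h,
      Q.convexHull_vertices]
  have hxP : x ∉ P.1 := by
    have hxQ := convexIndependent_set_iff_notMem_convexHull_sdiff.1 Q.convexIndependent_vertices x
      (h ▸ mem_insert x _)
    rwa [h, insert_sdiff_self_of_notMem hx, P.convexHull_vertices] at hxQ
  have hext : extremePoints ℝ (convexHull ℝ (P.1 ∪ {x})) = P.vertices ∪ {x} := by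
    rw [hQ, union_singleton, ← h]
    rfl
  exact Or.inl (Or.inl ⟨x, ⟨hxP, hext⟩, hQ.symm⟩)

theorem gamma_adj_of_vertices_subset {P Q : Polytope d} (h : P.vertices ⊆ Q.vertices)
    (hcard : P.vertices.ncard + 1 = Q.vertices.ncard) : (Gamma d).Adj P Q := by
  obtain ⟨x, hx, hPQ⟩ :=
    (exists_eq_insert_iff_ncard P.finite_vertices).2 ⟨h, hcard⟩
  exact gamma_adj_of_vertices_eq_insert hx hPQ.symm

/-- The vertices of the graph `Lambda d`. -/
abbrev LatticePolytope (d : ℕ) : Type :=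
  {P : Polytope d // P.IsLattice}

/-- The vertices of the graph `LambdaSimplex d`. -/
abbrev SmallLatticePolytope (d : ℕ) : Type :=
  {P : LatticePolytope d // P.1.IsSimplex ∨ P.1.vertices.ncard = d + 2}

theorem lambda_reachable_of_vertices_subset {P Q : LatticePolytope d}
    (h : P.1.vertices ⊆ Q.1.vertices) : (Lambda d).Reachable P Q := by
  induction hn : Q.1.vertices.ncard using Nat.strong_induction_on generalizing Q with
  | _ n ih =>
  by_cases hQP : Q.1.vertices ⊆ P.1.vertices
  · have hPQ : P = Q := Subtype.ext (Polytope.vertices_injective (h.antisymm hQP))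
    rw [hPQ]
  · obtain ⟨v, hvQ, hvP⟩ := not_subset.1 hQP
    have hsub : P.1.vertices ⊆ Q.1.vertices \ {v} := subset_sdiff_singleton h hvP
    obtain ⟨R, hR⟩ := Q.1.exists_vertices_eq_of_subset sdiff_subset
      (top_unique (P.1.affineSpan_vertices ▸ affineSpan_mono ℝ hsub))
    have hRQ : R.vertices ⊆ Q.1.vertices := hR ▸ sdiff_subset
    have hcard : R.vertices.ncard + 1 = Q.1.vertices.ncard := by
      rw [hR, ncard_sdiff_singleton_add_one hvQ Q.1.finite_vertices]
    have hPR := ih R.vertices.ncard (by lia) (Q := ⟨R, fun x hx => Q.2 x (hRQ hx)⟩) (hR ▸ hsub) rfl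
    have hadj : (Lambda d).Adj ⟨R, fun x hx => Q.2 x (hRQ hx)⟩ Q :=
      gamma_adj_of_vertices_subset hRQ hcard
    exact hPR.trans hadj.reachable

/-- The lattice `ℤ^d` in `ℝ^d`. The carrier is written so that `P.IsLattice` unfolds to
`P.vertices ⊆ integerLattice d`. -/
noncomputable def integerLattice (d : ℕ) : AddSubgroup (EuclideanSpace ℝ (Fin d)) where
  carrier := {x | ∀ i, ∃ n : ℤ, x i = n}
  zero_mem' _ := ⟨0, by simp⟩
  add_mem' hx hy i := by
    obtain ⟨m, hm⟩ := hx i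
    obtain ⟨n, hn⟩ := hy i
    exact ⟨m + n, by simp [hm, hn]⟩
  neg_mem' hx i := by
    obtain ⟨m, hm⟩ := hx i
    exact ⟨-m, by simp [hm]⟩

theorem affineSpan_integerLattice (d : ℕ) :
    affineSpan ℝ (integerLattice d : Set (EuclideanSpace ℝ (Fin d))) = ⊤ := by
  have hbasis (i : Fin d) : EuclideanSpace.basisFun (Fin d) ℝ i ∈ integerLattice d := fun j =>
    ⟨if j = i then 1 else 0, by simp⟩
  have hspan : Submodule.span ℝ (integerLattice d : Set (EuclideanSpace ℝ (Fin d))) = ⊤ := by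
    rw [← top_le_iff, ← (EuclideanSpace.basisFun (Fin d) ℝ).toBasis.span_eq]
    refine Submodule.span_mono (range_subset_iff.2 fun i => ?_)
    rw [OrthonormalBasis.coe_toBasis]
    exact hbasis i
  have hzero : insert 0 (integerLattice d : Set (EuclideanSpace ℝ (Fin d))) = integerLattice d :=
    insert_eq_of_mem (integerLattice d).zero_mem
  rw [← hzero, ← SetLike.coe_set_eq, affineSpan_insert_zero, hspan, Submodule.top_coe,
    AffineSubspace.top_coe]

/-- An affine basis of `ℝ^d` made of lattice points, that is, a lattice simplex with numbered
vertices. -/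
structure LatticeFrame (d : ℕ) extends
    AffineBasis (Fin (d + 1)) ℝ (EuclideanSpace ℝ (Fin d)) where
  mem_integerLattice (i : Fin (d + 1)) : toFun i ∈ integerLattice d

namespace LatticeFrame

noncomputable instance : CoeFun (LatticeFrame d) fun _ => Fin (d + 1) → EuclideanSpace ℝ (Fin d) :=
  ⟨fun b => b.toAffineBasis⟩

theorem exists_range_subset {s : Set (EuclideanSpace ℝ (Fin d))} (hs : s ⊆ integerLattice d)
    (hspan : affineSpan ℝ s = ⊤) : ∃ b : LatticeFrame d, range b ⊆ s := by
  obtain ⟨b, hb⟩ := exists_affineBasis_range_subset hspan finrank_euclideanSpace_fin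
  exact ⟨⟨b, fun i => hs (hb ⟨i, rfl⟩)⟩, hb⟩

theorem exists_eqOn_compl_singleton (b : LatticeFrame d) {i : Fin (d + 1)}
    {q : EuclideanSpace ℝ (Fin d)} (hq : q ∈ integerLattice d) (hbq : b.coord i q ≠ 0) :
    ∃ c : LatticeFrame d, EqOn b c {i}ᶜ ∧ c i = q := by
  obtain ⟨c, hc⟩ := exists_affineBasis_eq_update b.toAffineBasis hbq
  have hci : c i = q := by rw [hc, Function.update_self]
  have hbc : EqOn b c {i}ᶜ := fun l hl => by rw [hc, Function.update_of_ne hl]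
  refine ⟨⟨c, fun l => ?_⟩, hbc, hci⟩
  change c l ∈ _
  rcases eq_or_ne l i with rfl | hl
  exacts [hci ▸ hq, hbc hl ▸ b.mem_integerLattice l]

theorem ncard_range (b : LatticeFrame d) : (range b).ncard = d + 1 := by
  rw [← image_univ, ncard_image_of_injective _ b.ind.injective, ncard_univ, Nat.card_fin]

/-- The simplex spanned by a lattice frame. -/
def toPolytope (b : LatticeFrame d) : Polytope d :=
  ⟨convexHull ℝ (range b), ⟨range b, finite_range b, rfl⟩, by rw [affineSpan_convexHull, b.tot]⟩

theorem vertices_toPolytope (b : LatticeFrame d) : b.toPolytope.vertices = range b :=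
  extremePoints_convexHull_of_convexIndependent (finite_range b)
    (convexIndependent_of_affineIndependent b.ind).range

theorem isLattice_toPolytope (b : LatticeFrame d) : b.toPolytope.IsLattice := by
  intro v hv
  rw [b.vertices_toPolytope] at hv
  obtain ⟨i, rfl⟩ := hv
  exact b.mem_integerLattice i

theorem isSimplex_toPolytope (b : LatticeFrame d) : b.toPolytope.IsSimplex := by
  rw [Polytope.IsSimplex, b.vertices_toPolytope]
  exact b.ind.range

/-- The simplex spanned by a lattice frame, as a vertex of the graph `LambdaSimplex d`. -/
def simplex (b : LatticeFrame d) : SmallLatticePolytope d :=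
  ⟨⟨b.toPolytope, b.isLattice_toPolytope⟩, Or.inl b.isSimplex_toPolytope⟩

theorem simplex_eq_of_range_eq_vertices {b : LatticeFrame d} {P : SmallLatticePolytope d}
    (h : range b = P.1.1.vertices) : b.simplex = P :=
  Subtype.ext (Subtype.ext (Polytope.vertices_injective (b.vertices_toPolytope.trans h)))

theorem adj_simplex (b : LatticeFrame d) {P : SmallLatticePolytope d}
    (hb : range b ⊆ P.1.1.vertices) (hP : P.1.1.vertices.ncard = d + 2) :
    (LambdaSimplex d).Adj b.simplex P := by
  have hcard : b.toPolytope.vertices.ncard + 1 = P.1.1.vertices.ncard := by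
    rw [b.vertices_toPolytope, b.ncard_range, hP]
  exact gamma_adj_of_vertices_subset (b.vertices_toPolytope ▸ hb) hcard

section Exchange

variable {b c : LatticeFrame d} {i j k : Fin (d + 1)}

theorem reachable_simplex_of_coord_signs {m : Fin (d + 1)} (h : EqOn b c {i}ᶜ)
    (hm : b.coord m (c i) < 0) (hj : 0 < b.coord j (c i)) (hk : 0 < b.coord k (c i))
    (hjk : j ≠ k) : (LambdaSimplex d).Reachable b.simplex c.simplex := by
  have hci : c i ∉ range b := fun hmem =>
    notMem_convexHull_range_of_coord_neg b.toAffineBasis hm (subset_convexHull ℝ _ hmem)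
  obtain ⟨P, hP⟩ := Polytope.exists_vertices_eq ((finite_range b).insert (c i))
    (convexIndependent_insert_range b.toAffineBasis hm hj hk hjk)
    (top_unique (b.tot ▸ affineSpan_mono ℝ (subset_insert _ _)))
  have hPlattice : P.vertices ⊆ integerLattice d := by
    rw [hP, insert_subset_iff, range_subset_iff]
    exact ⟨c.mem_integerLattice i, b.mem_integerLattice⟩
  have hcard : P.vertices.ncard = d + 2 := by
    rw [hP, ncard_insert_of_notMem hci, b.ncard_range]
  have hbP : range b ⊆ P.vertices := hP ▸ subset_insert _ _
  have hcP : range c ⊆ P.vertices := by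
    rintro _ ⟨l, rfl⟩
    rw [hP]
    rcases eq_or_ne l i with rfl | hl
    exacts [mem_insert _ _, Or.inr ⟨l, h hl⟩]
  have hbadj := b.adj_simplex (P := ⟨⟨P, hPlattice⟩, Or.inr hcard⟩) hbP hcard
  have hcadj := c.adj_simplex (P := ⟨⟨P, hPlattice⟩, Or.inr hcard⟩) hcP hcard
  exact hbadj.reachable.trans hcadj.reachable.symm

theorem eventually_reachable_simplex_of_shear (hij : i ≠ j) (hik : i ≠ k) (hjk : j ≠ k)
    (h : EqOn b c {i}ᶜ) (hpos : 0 < c.coord i (b i)) :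
    ∀ᶠ M : ℕ in atTop, ∀ e : LatticeFrame d, EqOn c e {i}ᶜ →
      e i = b i + (M : ℝ) • (b j - b k) → (LambdaSimplex d).Reachable c.simplex e.simplex := by
  have hM (r : ℝ) : ∀ᶠ M : ℕ in atTop, r < M :=
    tendsto_natCast_atTop_atTop.eventually_gt_atTop r
  filter_upwards [hM (-c.coord j (b i)), hM (c.coord k (b i))] with M hMj hMk e hce hei
  have hcoord (l : Fin (d + 1)) :
      c.coord l (e i) = c.coord l (b i) + M * (c.coord l (c j) - c.coord l (c k)) := by
    rw [hei, affineMap_add_smul_sub, h hij.symm, h hik.symm, smul_eq_mul]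
  refine reachable_simplex_of_coord_signs (m := k) (j := i) (k := j) hce ?_ ?_ ?_ hij
  · rw [hcoord, c.coord_apply_eq, c.coord_apply_ne hjk.symm]
    linarith
  · rwa [hcoord, c.coord_apply_ne hij, c.coord_apply_ne hik, sub_self, mul_zero, add_zero]
  · rw [hcoord, c.coord_apply_eq, c.coord_apply_ne hjk]
    linarith

theorem reachable_simplex_of_coord_pos (hij : i ≠ j) (hik : i ≠ k) (hjk : j ≠ k)
    (h : EqOn b c {i}ᶜ) (hpos : 0 < c.coord i (b i)) :
    (LambdaSimplex d).Reachable b.simplex c.simplex := by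
  have hb := eventually_reachable_simplex_of_shear (b := b) hij hik hjk (eqOn_refl b _)
    (b.coord_apply_eq i ▸ one_pos)
  have hc := eventually_reachable_simplex_of_shear hij hik hjk h hpos
  obtain ⟨M, hbM, hcM⟩ := (hb.and hc).exists
  have hlattice : b i + (M : ℝ) • (b j - b k) ∈ integerLattice d := by
    rw [Nat.cast_smul_eq_nsmul]
    exact add_mem (b.mem_integerLattice i)
      (nsmul_mem (sub_mem (b.mem_integerLattice j) (b.mem_integerLattice k)) M)
  have hcoord : b.coord i (b i + (M : ℝ) • (b j - b k)) = 1 := by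
    rw [affineMap_add_smul_sub, b.coord_apply_eq, b.coord_apply_ne hij, b.coord_apply_ne hik,
      sub_self, smul_zero, add_zero]
  obtain ⟨e, hbe, hei⟩ := b.exists_eqOn_compl_singleton hlattice (hcoord ▸ one_ne_zero)
  exact (hbM e hbe hei).trans (hcM e (h.symm.trans hbe) hei).symm

theorem reachable_simplex_of_coord_neg (hij : i ≠ j) (hik : i ≠ k) (hjk : j ≠ k)
    (h : EqOn b c {i}ᶜ) (hneg : b.coord i (c i) < 0) :
    (LambdaSimplex d).Reachable b.simplex c.simplex := by
  have hlattice : b j + (1 : ℝ) • (b k - b i) ∈ integerLattice d := by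
    rw [one_smul]
    exact add_mem (b.mem_integerLattice j)
      (sub_mem (b.mem_integerLattice k) (b.mem_integerLattice i))
  have hcoord (l : Fin (d + 1)) : b.coord l (b j + (1 : ℝ) • (b k - b i)) =
      b.coord l (b j) + (b.coord l (b k) - b.coord l (b i)) := by
    rw [affineMap_add_smul_sub, one_smul]
  have hi : b.coord i (b j + (1 : ℝ) • (b k - b i)) = -1 := by
    rw [hcoord, b.coord_apply_ne hij, b.coord_apply_ne hik, b.coord_apply_eq]
    norm_num
  have hj : b.coord j (b j + (1 : ℝ) • (b k - b i)) = 1 := by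
    rw [hcoord, b.coord_apply_ne hij.symm, b.coord_apply_ne hjk, b.coord_apply_eq]
    norm_num
  have hk : b.coord k (b j + (1 : ℝ) • (b k - b i)) = 1 := by
    rw [hcoord, b.coord_apply_ne hik.symm, b.coord_apply_ne hjk.symm, b.coord_apply_eq]
    norm_num
  obtain ⟨e, hbe, hei⟩ := b.exists_eqOn_compl_singleton hlattice (by rw [hi]; norm_num)
  rw [← hei] at hi hj hk
  have hec : 0 < e.coord i (c i) := by
    have hmul := coord_eq_mul_coord_of_eqOn hbe (c i)
    rw [hi] at hmul
    linarith
  have hbe' : (LambdaSimplex d).Reachable b.simplex e.simplex :=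
    reachable_simplex_of_coord_signs hbe (hi ▸ neg_one_lt_zero) (hj ▸ one_pos) (hk ▸ one_pos) hjk
  exact hbe'.trans (reachable_simplex_of_coord_pos hij hik hjk (h.symm.trans hbe) hec).symm

theorem reachable_simplex_of_eqOn_compl_singleton (hd : 2 ≤ d) (h : EqOn b c {i}ᶜ) :
    (LambdaSimplex d).Reachable b.simplex c.simplex := by
  obtain ⟨j, hj, k, hk, hjk⟩ : ∃ j ∈ Finset.univ.erase i, ∃ k ∈ Finset.univ.erase i, j ≠ k :=
    Finset.one_lt_card.1
      (by rw [Finset.card_erase_of_mem (Finset.mem_univ i), Finset.card_fin]; lia)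
  have hij := (Finset.ne_of_mem_erase hj).symm
  have hik := (Finset.ne_of_mem_erase hk).symm
  have hmul := coord_eq_mul_coord_of_eqOn h (b i)
  rw [b.coord_apply_eq] at hmul
  have hne : b.coord i (c i) ≠ 0 := right_ne_zero_of_mul (hmul ▸ one_ne_zero)
  rcases hne.lt_or_gt with hneg | hpos
  · exact reachable_simplex_of_coord_neg hij hik hjk h hneg
  · exact (reachable_simplex_of_coord_pos hij hik hjk h.symm hpos).symm

end Exchange

theorem ncard_sdiff_range_lt {b b' c : LatticeFrame d} {i j : Fin (d + 1)} (h : EqOn b b' {i}ᶜ)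
    (hb : b i ∉ range c) (hb' : b' i = c j) (hj : c j ∉ range b) :
    (range c \ range b').ncard < (range c \ range b).ncard := by
  refine ncard_lt_ncard ⟨?_, fun hle => ?_⟩ (finite_range c).sdiff
  · rintro x ⟨hxc, hxb'⟩
    refine ⟨hxc, ?_⟩
    rintro ⟨l, rfl⟩
    have hl : l ≠ i := fun hl => hb (hl ▸ hxc)
    exact hxb' ⟨l, (h hl).symm⟩
  · exact (hle ⟨mem_range_self j, hj⟩).2 ⟨i, hb'⟩

theorem reachable_simplex (hd : 2 ≤ d) (b c : LatticeFrame d) :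
    (LambdaSimplex d).Reachable b.simplex c.simplex := by
  induction hn : (range c \ range b).ncard using Nat.strong_induction_on generalizing b with
  | _ n ih =>
  by_cases hcb : range c ⊆ range b
  · have hrange : range c = range b :=
      eq_of_subset_of_ncard_le hcb (by rw [b.ncard_range, c.ncard_range])
    have hbc : range b = c.simplex.1.1.vertices := hrange.symm.trans c.vertices_toPolytope.symm
    rw [simplex_eq_of_range_eq_vertices hbc]
  · obtain ⟨_, ⟨j, rfl⟩, hj⟩ := not_subset.1 hcb
    obtain ⟨i, hi, hij⟩ := exists_notMem_range_and_coord_ne_zero b.toAffineBasis c.toAffineBasis hj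
    obtain ⟨b', hbb', hb'⟩ := b.exists_eqOn_compl_singleton (c.mem_integerLattice j) hij
    have hlt := hn ▸ ncard_sdiff_range_lt hbb' hi hb' hj
    exact (reachable_simplex_of_eqOn_compl_singleton hd hbb').trans (ih _ hlt b' rfl)

end LatticeFrame

theorem exists_latticeFrame_range_subset_vertices (P : LatticePolytope d) :
    ∃ b : LatticeFrame d, range b ⊆ P.1.vertices :=
  LatticeFrame.exists_range_subset P.2 P.1.affineSpan_vertices

theorem exists_lambdaSimplex_reachable (P : SmallLatticePolytope d) :
    ∃ b : LatticeFrame d, (LambdaSimplex d).Reachable b.simplex P := by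
  obtain ⟨b, hb⟩ := exists_latticeFrame_range_subset_vertices P.1
  refine ⟨b, ?_⟩
  rcases P.2 with hP | hP
  · have hrange : range b = P.1.1.vertices :=
      eq_of_subset_of_ncard_le hb
        (by rw [b.ncard_range, Polytope.ncard_vertices_of_isSimplex hP]) P.1.1.finite_vertices
    rw [LatticeFrame.simplex_eq_of_range_eq_vertices hrange]
  · exact (b.adj_simplex hb hP).reachable

theorem exists_lambda_reachable (P : LatticePolytope d) :
    ∃ b : LatticeFrame d, (Lambda d).Reachable b.simplex.1 P := by
  obtain ⟨b, hb⟩ := exists_latticeFrame_range_subset_vertices P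
  exact ⟨b, lambda_reachable_of_vertices_subset (b.vertices_toPolytope ▸ hb)⟩

theorem lambdaSimplex_connected (hd : 2 ≤ d) : (LambdaSimplex d).Connected := by
  obtain ⟨b₀, -⟩ := LatticeFrame.exists_range_subset subset_rfl (affineSpan_integerLattice d)
  refine (SimpleGraph.connected_iff_exists_forall_reachable _).2 ⟨b₀.simplex, fun P => ?_⟩
  obtain ⟨b, hb⟩ := exists_lambdaSimplex_reachable P
  exact (b₀.reachable_simplex hd b).trans hb

theorem lambda_connected (hd : 2 ≤ d) : (Lambda d).Connected := by
  obtain ⟨P₀⟩ := (lambdaSimplex_connected hd).nonempty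
  refine (SimpleGraph.connected_iff_exists_forall_reachable _).2 ⟨P₀.1, fun P => ?_⟩
  obtain ⟨b, hb⟩ := exists_lambda_reachable P
  have hP₀ := ((lambdaSimplex_connected hd).preconnected P₀ b.simplex).map
    (SimpleGraph.Embedding.induce _).toHom
  exact hP₀.trans hb

end PolytopeMoves

theorem mainTheorem5 (d : ℕ) (hd : 2 ≤ d) :
    (PolytopeMoves.Lambda d).Connected ∧ (PolytopeMoves.LambdaSimplex d).Connected :=
  ⟨PolytopeMoves.lambda_connected hd, PolytopeMoves.lambdaSimplex_connected hd⟩
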